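/- Let $n\ge 3$, let $K$ be a field in which $(n-3)!\neq 0$ (for instance $\mathbb C$ or $\mathbb Q$), and let $k_1,\dots,k_n$ be vectors in a $K$-vector space with a symmetric bilinear form, whose associated square is written $p^2=p\cdot p$. Assume $k_a^2=0$ for all $a$ (massless particles) and $k_1+\dots+k_n=0$ (momentum conservation). For a finite set $S\subseteq\{2,\dots,n-1\}$ put $\sigma_S=\bigl(k_1+\sum_{a\in S}k_a\bigr)^2$, and assume that the kinematics is generic in the sense that $\sigma_S\neq0$ for every non-empty $S\subseteq\{3,\dots,n-1\}$. For $1\le m\le n-3$ let $$h_m=\frac1{m!}\sum_{\substack{a_1,\dots,a_m\in\{2,\dots,n-1\}\\ a_i\ne a_j\ (i\neq j)}}\sigma_{\{a_1,\dots,a_m\}}\,z_{a_1}\cdots z_{a_m}\Big|_{z_2=1}$$ be the gauge-fixed polynomials of the $n$-point scattering equations, viewed in $R=K[z_3,\dots,z_{n-1}]$, and let $I=\langle h_1,\dots,h_{n-3}\rangle\subseteq R$. For $f\in R$ let $\operatorname{in}(f)$ denote the homogeneous part of $f$ of degree $\deg f$ (with $\operatorname{in}(0)=0$), and let $\operatorname{in}(I)=\{\operatorname{in}(f):f\in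 I\}$. Set $d^*=(n-3)(n-4)/2$. Then for every integer $d>d^*$, every homogeneous polynomial $p\in R$ of degree $d$ (including $p=0$) lies in $\operatorname{in}(I)$, and hence in the ideal $\langle\operatorname{in}(I)\rangle$ generated by the initial forms. Moreover, every $f\in R$ can be written as $$f=\sum_{m=1}^{n-3}q_m h_m+r,\qquad q_m, r\in R,$$ with $\deg(q_mh_m)\le\deg f$ for every $m$ with $q_mh_m\neq0$, and $\deg r\le d^*$ (or $r=0$). -/

import Mathlib

open scoped Nat

noncomputable section

namespace Scattering

variable {K V : Type*} [Field K] [AddCommGroup V] [Module K V]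

/-- The invariant `σ_S = (k₁ + ∑_{a ∈ S} k_a)²`, where the square of a momentum `p` is `B p p`. -/
def sigma (B : LinearMap.BilinForm K V) (k : ℕ → V) (S : Finset ℕ) : K :=
  B (k 1 + ∑ a ∈ S, k a) (k 1 + ∑ a ∈ S, k a)

/-- The Dolan-Goddard polynomial `(1/m!) ∑ σ_{a₁…a_m} z_{a₁} ⋯ z_{a_m}` in the variables
`z_2, …, z_{n-1}`, the sum running over the `m`-tuples of pairwise distinct
labels `a_i ∈ A' = {2, …, n-1}`. -/
def dolanGoddard (B : LinearMap.BilinForm K V) (k : ℕ → V) (n m : ℕ) :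
    MvPolynomial (Finset.Icc 2 (n - 1)) K :=
  MvPolynomial.C (1 / (m ! : K)) *
    ∑ a : Fin m ↪ Finset.Icc 2 (n - 1),
      MvPolynomial.C (sigma B k (Finset.univ.image fun i => (a i : ℕ))) *
        ∏ i, MvPolynomial.X (a i)

/-- The gauge fixing `z_2 → 1`, leaving the `n - 3` variables `z_3, …, z_{n-1}`. -/
def gaugeFix (K : Type*) [Field K] (n : ℕ) :
    MvPolynomial (Finset.Icc 2 (n - 1)) K →ₐ[K] MvPolynomial (Finset.Icc 3 (n - 1)) K :=
  MvPolynomial.aeval fun a =>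
    if h : (a : ℕ) ∈ Finset.Icc 3 (n - 1) then MvPolynomial.X ⟨a, h⟩ else 1

/-- The polynomial `h_m` of the `n`-point scattering equations, after gauge fixing. -/
def h (B : LinearMap.BilinForm K V) (k : ℕ → V) (n m : ℕ) :
    MvPolynomial (Finset.Icc 3 (n - 1)) K :=
  gaugeFix K n (dolanGoddard B k n m)

/-- The ideal `I = ⟨h_1, …, h_{n-3}⟩`. -/
def scatteringIdeal (B : LinearMap.BilinForm K V) (k : ℕ → V) (n : ℕ) :
    Ideal (MvPolynomial (Finset.Icc 3 (n - 1)) K) :=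
  Ideal.span (h B k n '' Set.Icc 1 (n - 3))

/-- The initial form `in(f)`: the homogeneous part of `f` of degree `deg f` (with `in(0) = 0`). -/
def initialForm {ι : Type*} (f : MvPolynomial ι K) : MvPolynomial ι K :=
  MvPolynomial.homogeneousComponent f.totalDegree f

/-- `in(I)`: the collection of the initial forms of all elements of `I`. -/
def initialForms {ι : Type*} (I : Ideal (MvPolynomial ι K)) : Set (MvPolynomial ι K) :=
  initialForm '' (I : Set (MvPolynomial ι K))

/-- The critical degree `d* = (n-3)(n-4)/2`. For `n ≥ 3` neither the truncated
subtractions nor the division lose anything: the product is even, and it is `0` for `n = 3`. -/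
def criticalDegree (n : ℕ) : ℕ := (n - 3) * (n - 4) / 2

end Scattering

end

/-! # Initial forms of the ideal of the gauge-fixed scattering equations -/

/-! Let N = n - 3. Setting z_2 = 1 lowers the degree of exactly the terms containing z_2, so the
degree m part of h_m is the squarefree form ∑ σ_T z_T over m-subsets T of {3, …, n-1}, with every
coefficient nonzero. These forms already generate all monomials of degree > N(N-1)/2
(`monomial_mem_gradedSpan`). A monomial of full support is a multiple of the top form σ_A z_A. One
of support S ≠ A is z_S times a monomial in the variables of S, which the forms of S generate by
induction; multiplication by z_S turns these into the forms of A, up to monomials of larger support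
(`squarefreeExp_mul_mem_gradedSpan`). Replacing leading forms by the h_m costs only lower-degree
terms. This gives the initial forms at once, and the division by repetition. -/

noncomputable section

namespace Scattering

open MvPolynomial Finset

/-! ### Squarefree forms and the monomials they generate -/

section SquarefreeSystem

variable {K ι : Type*} [Field K]

/-- The exponent of the squarefree monomial `∏ a ∈ T, X a`. -/
def squarefreeExp (T : Finset ι) : ι →₀ ℕ := ∑ a ∈ T, Finsupp.single a 1

/-- The form `∑ c_T ∏ a ∈ T, X a`, the sum running over the `m`-element subsets `T` of `A`. -/
def squarefreeForm (c : Finset ι → K) (A : Finset ι) (m : ℕ) : MvPolynomial ι K :=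
  ∑ T ∈ A.powersetCard m, monomial (squarefreeExp T) (c T)

/-- The degree `d` part of the ideal generated in the variables of `A` by the forms
`squarefreeForm c A m`, `1 ≤ m ≤ #A`. -/
def gradedSpan (c : Finset ι → K) (A : Finset ι) (d : ℕ) : Submodule K (MvPolynomial ι K) :=
  Submodule.span K {p | ∃ (u : ι →₀ ℕ) (m : ℕ), u.support ⊆ A ∧ m ∈ Icc 1 #A ∧
    u.degree + m = d ∧ p = monomial u 1 * squarefreeForm c A m}

theorem degree_squarefreeExp (T : Finset ι) : (squarefreeExp T).degree = #T := by
  simp [squarefreeExp, map_sum]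

theorem squarefreeExp_apply [DecidableEq ι] (T : Finset ι) (a : ι) :
    squarefreeExp T a = if a ∈ T then 1 else 0 := by
  simp [squarefreeExp, Finsupp.finsetSum_apply, Finsupp.single_apply]

theorem support_add_squarefreeExp [DecidableEq ι] (u : ι →₀ ℕ) (T : Finset ι) :
    (u + squarefreeExp T).support = u.support ∪ T := by
  ext a
  simp [squarefreeExp_apply]
  tauto

theorem squarefreeExp_support_le (w : ι →₀ ℕ) : squarefreeExp w.support ≤ w := by
  classical
  intro a
  rw [squarefreeExp_apply]
  split_ifs with ha
  · exact Nat.one_le_iff_ne_zero.2 (Finsupp.mem_support_iff.1 ha)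
  · exact Nat.zero_le _

theorem monomial_squarefreeExp (T : Finset ι) (r : K) :
    monomial (squarefreeExp T) r = C r * ∏ a ∈ T, X a := by
  rw [squarefreeExp, monomial_sum_index]
  rfl

theorem isHomogeneous_squarefreeForm (c : Finset ι → K) (A : Finset ι) (m : ℕ) :
    (squarefreeForm c A m).IsHomogeneous m :=
  IsHomogeneous.sum _ _ _ fun T hT => isHomogeneous_monomial _ <| by
    rw [degree_squarefreeExp, (mem_powersetCard.1 hT).2]

/-- If `S ⊆ A`, then `z_S` times the form of `S` is, modulo monomials whose support is larger
than `S`, equal to `z_S` times the form of `A`. -/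
theorem squarefreeExp_mul_mem_gradedSpan {c : Finset ι → K} {A S : Finset ι} (hSA : S ⊆ A)
    {d : ℕ} (hbig : ∀ v : ι →₀ ℕ, v.support ⊆ A → S ⊂ v.support → v.degree = #S + d →
      monomial v (1 : K) ∈ gradedSpan c A (#S + d))
    {p : MvPolynomial ι K} (hp : p ∈ gradedSpan c S d) :
    monomial (squarefreeExp S) 1 * p ∈ gradedSpan c A (#S + d) := by
  classical
  induction hp using Submodule.span_induction with
  | zero => simp
  | add x y _ _ hx hy => rw [mul_add]; exact add_mem hx hy
  | smul r x _ hx => rw [mul_smul_comm]; exact Submodule.smul_mem _ _ hx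
  | mem x hx =>
    obtain ⟨u, m, hu, hm, hd, rfl⟩ := hx
    rw [mem_Icc] at hm
    have hsplit : squarefreeForm c A m = squarefreeForm c S m +
        ∑ T ∈ A.powersetCard m \ S.powersetCard m, monomial (squarefreeExp T) (c T) := by
      rw [squarefreeForm, squarefreeForm, add_comm,
        sum_sdiff (powersetCard_mono hSA)]
    have huS : (u + squarefreeExp S).support = S := by
      rw [support_add_squarefreeExp, union_eq_right.2 hu]
    have hdeg : (u + squarefreeExp S).degree + m = #S + d := by
      rw [map_add, degree_squarefreeExp]; omega
    have heq : monomial (squarefreeExp S) (1 : K) * (monomial u 1 * squarefreeForm c S m) =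
        monomial (u + squarefreeExp S) 1 * squarefreeForm c A m -
        ∑ T ∈ A.powersetCard m \ S.powersetCard m,
          c T • monomial (u + squarefreeExp S + squarefreeExp T) (1 : K) := by
      have : ∑ T ∈ A.powersetCard m \ S.powersetCard m,
          c T • monomial (u + squarefreeExp S + squarefreeExp T) (1 : K) =
          monomial (u + squarefreeExp S) 1 *
          ∑ T ∈ A.powersetCard m \ S.powersetCard m, monomial (squarefreeExp T) (c T) := by
        rw [mul_sum]
        refine sum_congr rfl fun T _ => ?_
        rw [monomial_mul, smul_monomial, smul_eq_mul, mul_one, one_mul]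
      rw [this, hsplit, mul_add, add_sub_cancel_right, ← mul_assoc, monomial_mul, one_mul,
        add_comm]
    rw [heq]
    refine sub_mem (Submodule.subset_span ⟨_, m, huS.trans_subset hSA,
      mem_Icc.2 ⟨hm.1, hm.2.trans (card_le_card hSA)⟩, hdeg, rfl⟩)
      (sum_mem fun T hT => Submodule.smul_mem _ _ ?_)
    rw [mem_sdiff, mem_powersetCard, mem_powersetCard] at hT
    have hTS : ¬ T ⊆ S := fun h => hT.2 ⟨h, hT.1.2⟩
    -- A set T not contained in S contributes a new variable, so the support grows strictly.
    refine hbig _ ?_ ?_ ?_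
    · rw [support_add_squarefreeExp, huS]
      exact union_subset hSA hT.1.1
    · rw [support_add_squarefreeExp, huS]
      exact ⟨subset_union_left, fun h => hTS (subset_union_right.trans h)⟩
    · rw [map_add, degree_squarefreeExp, hT.1.2, hdeg]

/-- Removing z_S from a monomial costs degree #S = s; the bound drops by at least as much from A to
S. -/
theorem choose_two_add_le {s t : ℕ} (h : s < t) : s * (s - 1) / 2 + s ≤ t * (t - 1) / 2 := by
  rw [← Nat.choose_two_right, ← Nat.choose_two_right]
  calc s.choose 2 + s = (s + 1).choose 2 := by
        rw [Nat.choose_succ_succ' s 1, Nat.choose_one_right, add_comm]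
    _ ≤ t.choose 2 := Nat.choose_le_choose 2 h

/-- If no coefficient vanishes, the squarefree forms in the variables of `A` generate
all monomials of degree greater than `#A (#A - 1) / 2`. -/
theorem monomial_mem_gradedSpan (c : Finset ι → K) (A : Finset ι)
    (hc : ∀ S ⊆ A, S.Nonempty → c S ≠ 0) (w : ι →₀ ℕ) (hw : w.support ⊆ A)
    (hdeg : #A * (#A - 1) / 2 < w.degree) :
    monomial w (1 : K) ∈ gradedSpan c A w.degree := by
  classical
  induction A using Finset.strongInduction generalizing w with
  | H A IH =>
  -- Inner induction for fixed A: larger supports come first.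
  induction hk : #A - #w.support using Nat.strong_induction_on generalizing w with
  | _ k ih =>
  set S := w.support with hS
  obtain ⟨w', hw'⟩ : ∃ w', w = squarefreeExp S + w' :=
    ⟨w - squarefreeExp S, (add_tsub_cancel_of_le (squarefreeExp_support_le w)).symm⟩
  have hw'S : w'.support ⊆ S := by
    rw [hS, hw', add_comm, support_add_squarefreeExp]
    exact subset_union_left
  have hd : w.degree = #S + w'.degree := by
    conv_lhs => rw [hw', map_add, degree_squarefreeExp]
  rcases hw.eq_or_ssubset with hSA | hSA
  · have hne : A.Nonempty := by
      rw [nonempty_iff_ne_empty, ← hSA]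
      intro h0
      rw [hS, Finsupp.support_eq_empty] at h0
      simp [h0] at hdeg
    have hcA := hc A subset_rfl hne
    have heq : monomial w (1 : K) =
        (c A)⁻¹ • (monomial w' 1 * squarefreeForm c A #A) := by
      rw [squarefreeForm, powersetCard_self, sum_singleton, monomial_mul, smul_monomial,
        smul_eq_mul, one_mul, inv_mul_cancel₀ hcA, hw', hSA, add_comm]
    rw [heq]
    refine Submodule.smul_mem _ _ (Submodule.subset_span ⟨w', #A, hw'S.trans hw,
      mem_Icc.2 ⟨hne.card_pos, le_rfl⟩, ?_, rfl⟩)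
    rw [hd, hSA, add_comm]
  · have hlt := card_lt_card hSA
    have hIH := IH S hSA (fun T hT => hc T (hT.trans hw)) w' hw'S (by
      have := choose_two_add_le hlt
      omega)
    have := squarefreeExp_mul_mem_gradedSpan (c := c) hw (d := w'.degree)
      (fun v hvA hSv hv => by
        rw [← hd] at hv ⊢
        rw [← hv]
        have h1 := card_lt_card hSv
        have h2 := card_le_card hvA
        exact ih _ (by omega) v hvA (by rw [hv]; exact hdeg) rfl) hIH
    rw [monomial_mul, one_mul, ← hw', ← hd] at this
    exact this

theorem mem_gradedSpan_of_isHomogeneous {c : Finset ι → K} {A : Finset ι}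
    (hc : ∀ S ⊆ A, S.Nonempty → c S ≠ 0) (hA : ∀ a, a ∈ A) {d : ℕ} {p : MvPolynomial ι K}
    (hp : p.IsHomogeneous d) (hd : #A * (#A - 1) / 2 < d) : p ∈ gradedSpan c A d := by
  rw [p.as_sum]
  refine sum_mem fun v hv => ?_
  have hvd := hp.degree_eq_sum_deg_support hv
  have hv1 : monomial v (coeff v p) = coeff v p • monomial v (1 : K) := by
    rw [smul_monomial, smul_eq_mul, mul_one]
  have hvd' : v.degree = d := by
    rw [hvd, Finsupp.degree_apply]
  rw [hv1, ← hvd']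
  exact Submodule.smul_mem _ _
    (monomial_mem_gradedSpan c A hc v (fun a _ => hA a) (by rwa [hvd']))

/-- Since `d - m` truncates to 0 for `d < m`, vanishing of `q m` there is recorded separately. -/
theorem exists_homogeneous_coeff_of_mem_gradedSpan {c : Finset ι → K} {A : Finset ι} {d : ℕ}
    {p : MvPolynomial ι K} (hp : p ∈ gradedSpan c A d) :
    ∃ q : ℕ → MvPolynomial ι K, p = ∑ m ∈ Icc 1 #A, q m * squarefreeForm c A m ∧
      ∀ m, (q m).IsHomogeneous (d - m) ∧ (d < m → q m = 0) := by
  classical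
  induction hp using Submodule.span_induction with
  | zero => exact ⟨0, by simp, fun m => ⟨isHomogeneous_zero _ _ _, fun _ => rfl⟩⟩
  | add x y _ _ hx hy =>
    obtain ⟨q, rfl, hq⟩ := hx
    obtain ⟨q', rfl, hq'⟩ := hy
    refine ⟨q + q', by simp [add_mul, sum_add_distrib], fun m =>
      ⟨(hq m).1.add (hq' m).1, fun h => by simp [(hq m).2 h, (hq' m).2 h]⟩⟩
  | smul r x _ hx =>
    obtain ⟨q, rfl, hq⟩ := hx
    refine ⟨fun m => C r * q m, by simp [smul_sum, smul_eq_C_mul, mul_assoc], fun m =>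
      ⟨(hq m).1.C_mul r, fun h => by simp [(hq m).2 h]⟩⟩
  | mem x hx =>
    obtain ⟨u, m, -, hm, hd, rfl⟩ := hx
    refine ⟨Pi.single m (monomial u 1), ?_, fun j => ?_⟩
    · rw [sum_eq_single_of_mem m hm fun j _ hj => by rw [Pi.single_eq_of_ne hj, zero_mul],
        Pi.single_eq_same]
    · by_cases hj : j = m
      · subst hj
        rw [Pi.single_eq_same]
        exact ⟨isHomogeneous_monomial _ (by omega), fun h => by omega⟩
      · rw [Pi.single_eq_of_ne hj]
        exact ⟨isHomogeneous_zero _ _ _, fun _ => rfl⟩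

end SquarefreeSystem

/-! ### From leading forms to inhomogeneous generators -/

section Deformation

variable {K ι : Type*} [Field K]

theorem totalDegree_le_of_homogeneousComponent_eq_zero {f : MvPolynomial ι K} {d : ℕ}
    (hf : f.totalDegree ≤ d + 1) (h0 : homogeneousComponent (d + 1) f = 0) :
    f.totalDegree ≤ d := by
  by_contra hlt
  have hd : f.totalDegree = d + 1 := by omega
  have hne : f.support.Nonempty := by
    rw [support_nonempty]
    rintro rfl
    simp at hd
  obtain ⟨v, hv, hvd⟩ := Finset.exists_mem_eq_sup f.support hne fun s => s.sum fun _ e => e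
  have hvd' : v.degree = d + 1 := by
    rw [← hd, totalDegree, hvd, Finsupp.degree_apply]
    rfl
  have := congrArg (coeff v) h0
  rw [coeff_homogeneousComponent, if_pos hvd', coeff_zero] at this
  exact mem_support_iff.1 hv this

/-- Let `F m` have leading form `squarefreeForm c A m`. Then every form of degree greater than
`#A (#A - 1) / 2` is, up to terms of lower degree, a combination of the `F m`. -/
theorem exists_sub_sum_totalDegree_lt {c : Finset ι → K} {A : Finset ι}
    (hc : ∀ S ⊆ A, S.Nonempty → c S ≠ 0) (hA : ∀ a, a ∈ A) {F : ℕ → MvPolynomial ι K}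
    (hF : ∀ m ∈ Icc 1 #A, (F m - squarefreeForm c A m).totalDegree < m) {d : ℕ}
    {p : MvPolynomial ι K} (hp : p.IsHomogeneous d) (hd : #A * (#A - 1) / 2 < d) :
    ∃ q : ℕ → MvPolynomial ι K, (∀ m ∈ Icc 1 #A, (q m * F m).totalDegree ≤ d) ∧
      (p - ∑ m ∈ Icc 1 #A, q m * F m).totalDegree < d := by
  obtain ⟨q, hpq, hq⟩ :=
    exists_homogeneous_coeff_of_mem_gradedSpan (mem_gradedSpan_of_isHomogeneous hc hA hp hd)
  refine ⟨q, fun m hm => ?_, ?_⟩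
  · rcases lt_or_ge d m with hdm | hdm
    · simp [(hq m).2 hdm]
    · have h1 : (F m).totalDegree ≤ m := by
        rw [← sub_add_cancel (F m) (squarefreeForm c A m)]
        exact (totalDegree_add _ _).trans
          (max_le (hF m hm).le (isHomogeneous_squarefreeForm c A m).totalDegree_le)
      have h2 := (hq m).1.totalDegree_le
      exact (totalDegree_mul _ _).trans (by omega)
  -- The leading forms cancel `p` exactly; only the lower-order tails of the `F m` remain.
  · have heq : p - ∑ m ∈ Icc 1 #A, q m * F m =
        -∑ m ∈ Icc 1 #A, q m * (F m - squarefreeForm c A m) := by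
      simp only [mul_sub, sum_sub_distrib, ← hpq, neg_sub]
    rw [heq, totalDegree_neg, ← Nat.le_sub_one_iff_lt (by omega)]
    refine totalDegree_finsetSum_le fun m hm => ?_
    rcases lt_or_ge d m with hdm | hdm
    · simp [(hq m).2 hdm]
    · have h1 := hF m hm
      have h2 := (hq m).1.totalDegree_le
      exact (totalDegree_mul _ _).trans (by omega)

/-- While the degree bound exceeds the critical value, the top component can be traded for terms of
lower degree. -/
theorem exists_division {c : Finset ι → K} {A : Finset ι}
    (hc : ∀ S ⊆ A, S.Nonempty → c S ≠ 0) (hA : ∀ a, a ∈ A) {F : ℕ → MvPolynomial ι K}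
    (hF : ∀ m ∈ Icc 1 #A, (F m - squarefreeForm c A m).totalDegree < m) (d : ℕ)
    (f : MvPolynomial ι K) (hf : f.totalDegree ≤ d) :
    ∃ (q : ℕ → MvPolynomial ι K) (r : MvPolynomial ι K),
      f = ∑ m ∈ Icc 1 #A, q m * F m + r ∧
      (∀ m ∈ Icc 1 #A, (q m * F m).totalDegree ≤ d) ∧
      r.totalDegree ≤ #A * (#A - 1) / 2 := by
  induction d generalizing f with
  | zero => exact ⟨0, f, by simp, by simp, hf.trans (Nat.zero_le _)⟩
  | succ d ih =>
    rcases le_or_gt (d + 1) (#A * (#A - 1) / 2) with hd | hd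
    · exact ⟨0, f, by simp, by simp, hf.trans hd⟩
    set p := homogeneousComponent (d + 1) f with hpdef
    have hp : p.IsHomogeneous (d + 1) := homogeneousComponent_isHomogeneous _ _
    obtain ⟨q, hq, hlt⟩ := exists_sub_sum_totalDegree_lt hc hA hF hp hd
    have hfp : (f - p).totalDegree ≤ d := by
      refine totalDegree_le_of_homogeneousComponent_eq_zero
        ((totalDegree_sub _ _).trans (max_le hf hp.totalDegree_le)) ?_
      rw [map_sub, homogeneousComponent_eq_self hp, sub_self]
    have hdeg : (f - ∑ m ∈ Icc 1 #A, q m * F m).totalDegree ≤ d := by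
      rw [← sub_add_sub_cancel f p]
      exact (totalDegree_add _ _).trans (max_le hfp (Nat.lt_succ_iff.1 hlt))
    obtain ⟨q', r, hfr, hq', hr⟩ := ih _ hdeg
    refine ⟨q + q', r, ?_, fun m hm => ?_, hr⟩
    · rw [← add_sub_cancel (∑ m ∈ Icc 1 #A, q m * F m) f, hfr]
      simp only [Pi.add_apply, add_mul, sum_add_distrib, add_assoc]
    · rw [Pi.add_apply, add_mul]
      exact (totalDegree_add _ _).trans (max_le (hq m hm) ((hq' m hm).trans d.le_succ))

theorem mem_initialForms_of_sub_totalDegree_lt {I : Ideal (MvPolynomial ι K)} {d : ℕ}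
    {p g : MvPolynomial ι K} (hp : p.IsHomogeneous d) (hg : g ∈ I)
    (hlt : (p - g).totalDegree < d) : p ∈ initialForms I := by
  by_cases h0 : p = 0
  -- Separate case: `totalDegree 0` is 0, not `d`.
  · exact ⟨0, I.zero_mem, by simp [initialForm, h0]⟩
  have hg' : g = p + -(p - g) := by ring
  have hdeg : g.totalDegree = d := by
    rw [hg', totalDegree_add_eq_left_of_totalDegree_lt, hp.totalDegree h0]
    rwa [totalDegree_neg, hp.totalDegree h0]
  refine ⟨g, hg, ?_⟩
  rw [initialForm, hdeg, hg', map_add, map_neg, homogeneousComponent_eq_self hp,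
    homogeneousComponent_eq_zero _ _ hlt, neg_zero, add_zero]

end Deformation

/-! ### The leading forms of the scattering polynomials -/

theorem card_filter_univ_map_eq {E : Type*} [Fintype E] [DecidableEq E] {m : ℕ} {T : Finset E}
    (hT : #T = m) : #{a : Fin m ↪ E | univ.map a = T} = m ! := by
  have hcard : Fintype.card (Fin m ≃ T) = m ! := by
    rw [Fintype.card_equiv (Fintype.equivOfCardEq (by simp [hT])), Fintype.card_fin]
  rw [← hcard, ← card_univ]
  symm
  refine card_bij (fun e _ => e.toEmbedding.trans (Function.Embedding.subtype _)) ?_ ?_ ?_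
  · intro e _
    rw [mem_filter]
    refine ⟨mem_univ _, ?_⟩
    rw [← map_map, Finset.map_univ_equiv]
    ext x
    simp
  · intro e _ e' _ h
    ext i
    exact DFunLike.congr_fun h i
  · intro a ha
    have ha' := (mem_filter.1 ha).2
    have hmem : ∀ i, a i ∈ T := fun i => by rw [← ha']; exact mem_map_of_mem _ (mem_univ i)
    refine ⟨Equiv.ofBijective (fun i => ⟨a i, hmem i⟩) ⟨fun i j hij => a.injective
      (congrArg Subtype.val hij), fun x => ?_⟩, mem_univ _, ?_⟩
    · have hx : (x : E) ∈ univ.map a := by rw [ha']; exact x.2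
      obtain ⟨i, -, hi⟩ := mem_map.1 hx
      exact ⟨i, Subtype.ext hi⟩
    · ext i
      rfl

/-- Each m-subset is the image of m! injective tuples; this absorbs the factor 1/m! in
`dolanGoddard`. -/
theorem sum_embedding_eq_factorial_smul {E M : Type*} [Fintype E] [DecidableEq E]
    [AddCommMonoid M] (m : ℕ) (f : Finset E → M) :
    ∑ a : Fin m ↪ E, f (univ.map a) = m ! • ∑ T ∈ powersetCard m univ, f T := by
  rw [← sum_fiberwise_of_maps_to (t := powersetCard m univ) (g := fun a : Fin m ↪ E => univ.map a)
    (fun a _ => by simp [mem_powersetCard]), smul_sum]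
  refine sum_congr rfl fun T hT => ?_
  rw [sum_congr rfl fun a ha => by rw [(mem_filter.1 ha).2], sum_const,
    card_filter_univ_map_eq (mem_powersetCard.1 hT).2]

variable {K V : Type*} [Field K] [AddCommGroup V] [Module K V]

theorem h_eq_sum_powersetCard (B : LinearMap.BilinForm K V) (k : ℕ → V) (n : ℕ) {m : ℕ}
    (hm : (m ! : K) ≠ 0) :
    h B k n m = ∑ T ∈ powersetCard m (univ : Finset (Icc 2 (n - 1))),
      C (sigma B k (T.map (Function.Embedding.subtype _))) *
        ∏ a ∈ T, gaugeFix K n (X a) := by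
  have hsum : ∑ a : Fin m ↪ Icc 2 (n - 1),
      C (sigma B k (univ.image fun i => (a i : ℕ))) * ∏ i, (X (a i) : MvPolynomial _ K) =
      (m ! : MvPolynomial (Icc 2 (n - 1)) K) *
      ∑ T ∈ powersetCard m (univ : Finset (Icc 2 (n - 1))),
        C (sigma B k (T.map (Function.Embedding.subtype _))) * ∏ a ∈ T, X a := by
    rw [← nsmul_eq_mul, ← sum_embedding_eq_factorial_smul m fun T : Finset (Icc 2 (n - 1)) =>
      C (sigma B k (T.map (Function.Embedding.subtype _))) * ∏ a ∈ T, (X a : MvPolynomial _ K)]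
    refine sum_congr rfl fun a _ => ?_
    rw [prod_map, map_map, map_eq_image]
    rfl
  have hC : (C (1 / (m ! : K)) : MvPolynomial (Icc 2 (n - 1)) K) *
      (m ! : MvPolynomial (Icc 2 (n - 1)) K) = 1 := by
    rw [← map_natCast C, ← C_mul, one_div, inv_mul_cancel₀ hm, C_1]
  rw [h, dolanGoddard, hsum, ← mul_assoc, hC, one_mul, map_sum]
  refine sum_congr rfl fun T _ => ?_
  rw [map_mul, map_prod, algHom_C, algebraMap_eq]

theorem gaugeFix_X_of_mem {n : ℕ} (a : Icc 2 (n - 1)) (ha : (a : ℕ) ∈ Icc 3 (n - 1)) :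
    gaugeFix K n (X a) = X ⟨a, ha⟩ := by
  rw [gaugeFix, aeval_X, dif_pos ha]

theorem gaugeFix_X_of_notMem {n : ℕ} (a : Icc 2 (n - 1)) (ha : (a : ℕ) ∉ Icc 3 (n - 1)) :
    gaugeFix K n (X a) = 1 := by
  rw [gaugeFix, aeval_X, dif_neg ha]

theorem totalDegree_gaugeFix_X_le {n : ℕ} (a : Icc 2 (n - 1)) :
    (gaugeFix K n (X a)).totalDegree ≤ 1 := by
  by_cases ha : (a : ℕ) ∈ Icc 3 (n - 1)
  · rw [gaugeFix_X_of_mem a ha, totalDegree_X]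
  · simp [gaugeFix_X_of_notMem a ha]

theorem totalDegree_h_sub_squarefreeForm_lt (B : LinearMap.BilinForm K V) (k : ℕ → V) (n : ℕ)
    {m : ℕ} (hm : (m ! : K) ≠ 0) (hm0 : 0 < m) :
    (h B k n m - squarefreeForm
      (fun S : Finset (Icc 3 (n - 1)) => sigma B k (S.map (Function.Embedding.subtype _)))
      univ m).totalDegree < m := by
  classical
  have hsub : Icc 3 (n - 1) ⊆ Icc 2 (n - 1) := Icc_subset_Icc_left (by norm_num)
  let e : Icc 3 (n - 1) ↪ Icc 2 (n - 1) := ⟨fun a => ⟨a, hsub a.2⟩, fun a b hab =>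
    Subtype.ext (Subtype.mk.inj hab)⟩
  have hform : squarefreeForm
      (fun S : Finset (Icc 3 (n - 1)) => sigma B k (S.map (Function.Embedding.subtype _)))
      univ m = ∑ T ∈ powersetCard m (univ.map e),
        C (sigma B k (T.map (Function.Embedding.subtype _))) * ∏ a ∈ T, gaugeFix K n (X a) := by
    rw [powersetCard_map, sum_map, squarefreeForm]
    refine sum_congr rfl fun T _ => ?_
    rw [monomial_squarefreeExp, RelEmbedding.coe_toEmbedding, mapEmbedding_apply, prod_map,
      Finset.map_map]
    congr 1
    exact prod_congr rfl fun a _ => (gaugeFix_X_of_mem (e a) a.2).symm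
  rw [h_eq_sum_powersetCard B k n hm, hform,
    ← sum_sdiff (powersetCard_mono (subset_univ (univ.map e))), add_sub_cancel_right,
    ← Nat.le_sub_one_iff_lt hm0]
  refine totalDegree_finsetSum_le fun T hT => ?_
  rw [mem_sdiff, mem_powersetCard, mem_powersetCard] at hT
  obtain ⟨⟨-, hTm⟩, hT⟩ := hT
  -- The surviving T contain the label 2, whose variable becomes 1, leaving at most m - 1 factors of
  -- positive degree.
  obtain ⟨b, hbT, hb⟩ : ∃ b ∈ T, (b : ℕ) ∉ Icc 3 (n - 1) := by
    by_contra! hall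
    exact hT ⟨fun b hb => mem_map.2 ⟨⟨b, hall b hb⟩, mem_univ _, rfl⟩, hTm⟩
  rw [← mul_prod_erase T _ hbT, gaugeFix_X_of_notMem b hb, one_mul]
  calc _ ≤ 0 + ∑ a ∈ T.erase b, (gaugeFix K n (X a)).totalDegree :=
        (totalDegree_mul _ _).trans
          (add_le_add (totalDegree_C _).le (totalDegree_finsetProd _ _))
    _ ≤ 0 + ∑ a ∈ T.erase b, 1 := by gcongr with a _; exact totalDegree_gaugeFix_X_le a
    _ = m - 1 := by rw [zero_add, sum_const, smul_eq_mul, mul_one, card_erase_of_mem hbT, hTm]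

end Scattering

end

theorem mainTheorem2 {K V : Type*} [Field K] [AddCommGroup V] [Module K V]
    (n : ℕ) (hn : 3 ≤ n) (hfact : ((n - 3)! : K) ≠ 0)
    (B : LinearMap.BilinForm K V) (hB : B.IsSymm) (k : ℕ → V)
    (hmassless : ∀ a ∈ Finset.Icc 1 n, B (k a) (k a) = 0)
    (hcons : ∑ a ∈ Finset.Icc 1 n, k a = 0)
    (hgeneric : ∀ S ⊆ Finset.Icc 3 (n - 1), S.Nonempty → Scattering.sigma B k S ≠ 0) :
    (∀ d > Scattering.criticalDegree n, ∀ p : MvPolynomial (Finset.Icc 3 (n - 1)) K,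
      p.IsHomogeneous d →
        p ∈ Scattering.initialForms (Scattering.scatteringIdeal B k n) ∧
        p ∈ Ideal.span (Scattering.initialForms (Scattering.scatteringIdeal B k n))) ∧
    (∀ f : MvPolynomial (Finset.Icc 3 (n - 1)) K,
      ∃ (q : ℕ → MvPolynomial (Finset.Icc 3 (n - 1)) K)
        (r : MvPolynomial (Finset.Icc 3 (n - 1)) K),
        f = ∑ m ∈ Finset.Icc 1 (n - 3), q m * Scattering.h B k n m + r ∧
        (∀ m ∈ Finset.Icc 1 (n - 3),
          (q m * Scattering.h B k n m).totalDegree ≤ f.totalDegree) ∧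
        r.totalDegree ≤ Scattering.criticalDegree n) := by
  let c : Finset (Finset.Icc 3 (n - 1)) → K := fun S =>
    Scattering.sigma B k (S.map (Function.Embedding.subtype _))
  have hc : ∀ S ⊆ (Finset.univ : Finset (Finset.Icc 3 (n - 1))), S.Nonempty → c S ≠ 0 := by
    intro S _ hS
    refine hgeneric _ (fun x hx => ?_) (hS.map)
    obtain ⟨a, -, rfl⟩ := Finset.mem_map.1 hx
    exact a.2
  have hcard : (Finset.univ : Finset (Finset.Icc 3 (n - 1))).card = n - 3 := by
    rw [Finset.card_univ, Fintype.card_coe, Nat.card_Icc]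
    omega
  have hF : ∀ m ∈ Finset.Icc 1 (Finset.univ : Finset (Finset.Icc 3 (n - 1))).card,
      (Scattering.h B k n m - Scattering.squarefreeForm c Finset.univ m).totalDegree < m := by
    intro m hm
    rw [hcard, Finset.mem_Icc] at hm
    refine Scattering.totalDegree_h_sub_squarefreeForm_lt B k n (fun h0 => hfact ?_) hm.1
    -- As m! divides (n-3)!, it is also nonzero in K.
    obtain ⟨j, hj⟩ := Nat.factorial_dvd_factorial hm.2
    rw [hj, Nat.cast_mul, h0, zero_mul]
  have hcrit : Scattering.criticalDegree n = (n - 3) * ((n - 3) - 1) / 2 := by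
    rw [Scattering.criticalDegree, Nat.sub_sub]
  have huniv : ∀ a, a ∈ (Finset.univ : Finset (Finset.Icc 3 (n - 1))) := Finset.mem_univ
  rw [hcrit]
  constructor
  · intro d hd p hp
    obtain ⟨q, -, hlt⟩ := Scattering.exists_sub_sum_totalDegree_lt hc huniv hF hp
      (by rwa [hcard])
    rw [hcard] at hlt
    have hmem : p ∈ Scattering.initialForms (Scattering.scatteringIdeal B k n) :=
      Scattering.mem_initialForms_of_sub_totalDegree_lt hp
        (sum_mem fun m hm => Ideal.mul_mem_left _ _
          (Ideal.subset_span ⟨m, Finset.coe_Icc 1 (n - 3) ▸ hm, rfl⟩)) hlt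
    exact ⟨hmem, Ideal.subset_span hmem⟩
  · intro f
    have := Scattering.exists_division hc huniv hF f.totalDegree f le_rfl
    rwa [hcard] at this
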